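/- A PD0L system over a finite alphabet $A$ is given by a tuple $(h_0,\dots,h_{p-1})$, $p\ge 1$, of morphisms $h_i\colon A^*\to A^*$ and a word $s\in A^*$ such that $s$ is a prefix of $H(s)$, where $H(a_0a_1\cdots a_m)=h_{0 \bmod p}(a_0)\,h_{1 \bmod p}(a_1)\cdots h_{m \bmod p}(a_m)$. It is non-erasing if $h_i(a)\neq\varepsilon$ for all $i$ and all $a\in A$. Its PD0L word is the limit of the words $H^i(s)$ as $i\to\infty$, for the metric $d(u,v)=2^{-\ell}$ with $\ell$ the length of the longest common prefix of $u$ and $v$. The first-order theory of an infinite word $x\in A^{\mathbb N}$ is the set of first-order sentences that are true in the structure $(\mathbb N,<,(P_a)_{a\in A})$, where $P_a(i)$ holds if and only if $x(i)=a$. **Theorem.** The first-order theory of PD0L words is undecidable: there is no algorithm that, given a PD0L system over an alphabet $\{0,\dots,n-1\}$ that generates an infinite word $x$, and given a first-order sentence $\varphi$ over the signature $<,P_0,\dots,P_{n-1}$, decides whether $\varphi$ belongs to the first-order theory of $x$. There is no such algorithm even if it only has to be correct for non-erasing PD0L systems. -/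

import Mathlib

open FirstOrder

/-- The map `H` on finite words given by a tuple of morphisms `h 0, …, h (p - 1)`, each morphism
being given by its values on letters: the letter at position `i` is replaced by its image under
`h (i mod p)`, and the resulting words are concatenated. -/
def periodicMap {A : Type} {p : ℕ} (hp : 0 < p) (h : Fin p → A → List A) (w : List A) : List A :=
  (w.mapIdx fun i a => h ⟨i % p, Nat.mod_lt i hp⟩ a).flatten

/-- PD0L systems over the alphabet `A`. -/
structure PD0LSystem (A : Type) where
  /-- the number of morphisms -/
  p : ℕ
  p_pos : 0 < p
  /-- the morphisms, given by their values on letters -/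
  h : Fin p → A → List A
  /-- the start word -/
  s : List A
  s_prefix : s <+: periodicMap p_pos h s

namespace PD0LSystem

variable {A : Type}

/-- The map `H` of the system. -/
def H (S : PD0LSystem A) : List A → List A := periodicMap S.p_pos S.h

/-- All morphisms are non-erasing. -/
def NonErasing (S : PD0LSystem A) : Prop := ∀ i a, S.h i a ≠ []

/-- The infinite word `x` is the PD0L word of `S`, that is, the limit of the words `H^i(s)` for the
metric `d(u, v) = 2 ^ (-length of the longest common prefix of u and v)`: every finite
prefix of `x` is a prefix of `H^i(s)` for all sufficiently large `i`. -/
def Generates (S : PD0LSystem A) (x : ℕ → A) : Prop :=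
  ∀ k : ℕ, ∃ N : ℕ, ∀ i ≥ N, List.ofFn (fun j : Fin k => x j) <+: S.H^[i] S.s

/-- The system written down as finite data, for a system over the alphabet `{0, …, n - 1}`:
the size of the alphabet, the table of the words `h i a`, and the start word. -/
def code {n : ℕ} (S : PD0LSystem (Fin n)) : ℕ × List (List (List ℕ)) × List ℕ :=
  (n, List.ofFn (fun i => List.ofFn fun a => (S.h i a).map Fin.val), S.s.map Fin.val)

theorem code_injective {n : ℕ} : Function.Injective (code (n := n)) := by
  rintro ⟨p, hp, h, s, hs⟩ ⟨q, hq, g, t, ht⟩ e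
  have hF : Function.Injective (List.map (Fin.val : Fin n → ℕ)) :=
    List.map_injective_iff.2 Fin.val_injective
  simp only [code, Prod.mk.injEq, true_and] at e
  obtain ⟨e1, e2⟩ := e
  obtain rfl := hF e2
  obtain rfl : p = q := by simpa using congrArg List.length e1
  have e3 := List.ofFn_injective e1
  have : h = g := by
    funext i a
    exact hF (congrFun (List.ofFn_injective (congrFun e3 i)) a)
  subst this
  rfl

end PD0LSystem

/-- The relation symbols of the first-order language of infinite words over `A`: the order
of positions, and for each letter `a` a unary predicate. -/
inductive WordRel (A : Type) : ℕ → Type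
  | lt : WordRel A 2
  | letter (a : A) : WordRel A 1

/-- The first-order language of infinite words over `A` (with equality, as always). -/
def wordLanguage (A : Type) : Language := ⟨fun _ => Empty, WordRel A⟩

/-- The infinite word `x` as a first-order structure: the domain is the set `ℕ` of positions, `<` is
the usual order, and `letter a` holds at position `i` when `x i = a`. -/
@[reducible] def wordStructure {A : Type} (x : ℕ → A) : (wordLanguage A).Structure ℕ where
  funMap := fun f _ => nomatch f
  RelMap := fun R v =>
    match R, v with
    | WordRel.lt, v => v 0 < v 1
    | WordRel.letter a, v => x (v 0) = a

/-- The sentence `φ` is true in the infinite word `x`, that is, belongs to the first-order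
theory of `x`. -/
def WordSatisfies {A : Type} (x : ℕ → A) (φ : (wordLanguage A).Sentence) : Prop :=
  @Language.Sentence.Realize (wordLanguage A) ℕ (wordStructure x) φ

/-- A term of the language is a variable; its code is the (de Bruijn) index of the variable. -/
def termCode {A : Type} {k : ℕ} : (wordLanguage A).Term (Empty ⊕ Fin k) → ℕ
  | .var (.inr i) => i.val
  | .var (.inl e) => nomatch e
  | .func f _ => nomatch f

/-- A Gödel numbering of the formulas of the language over the alphabet `{0, …, n - 1}`. -/
def formulaCode {n : ℕ} : {k : ℕ} → (wordLanguage (Fin n)).BoundedFormula Empty k → ℕ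
  | _, .falsum => Nat.pair 0 0
  | _, .equal t u => Nat.pair 1 (Nat.pair (termCode t) (termCode u))
  | _, .rel WordRel.lt ts => Nat.pair 2 (Nat.pair (termCode (ts 0)) (termCode (ts 1)))
  | _, .rel (WordRel.letter a) ts => Nat.pair 3 (Nat.pair a.val (termCode (ts 0)))
  | _, .imp φ ψ => Nat.pair 4 (Nat.pair (formulaCode φ) (formulaCode ψ))
  | _, .all φ => Nat.pair 5 (formulaCode φ)

theorem termCode_injective {A : Type} {k : ℕ} :
    Function.Injective (termCode (A := A) (k := k)) := by
  intro t u e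
  match t, u with
  | .var (.inr i), .var (.inr j) =>
    obtain rfl : i = j := Fin.ext e
    rfl
  | .var (.inl e), _ => exact nomatch e
  | _, .var (.inl e) => exact nomatch e
  | .func f _, _ => exact nomatch f
  | _, .func f _ => exact nomatch f

theorem formulaCode_injective {n k : ℕ} :
    Function.Injective (formulaCode (n := n) (k := k)) := by
  intro φ ψ e
  induction φ with
  | falsum => rcases ψ with _ | _ | ⟨_ | _, _⟩ | _ | _ <;> simp_all [formulaCode]
  | equal t u =>
    rcases ψ with _ | _ | ⟨_ | _, _⟩ | _ | _ <;> simp_all [formulaCode, termCode_injective.eq_iff]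
  | rel R ts =>
    rcases R with _ | a <;> rcases ψ with _ | _ | ⟨_ | b, us⟩ | _ | _ <;>
      simp only [formulaCode, Nat.pair_eq_pair, termCode_injective.eq_iff, Fin.val_inj] at e <;>
      try omega
    · congr 1
      funext i
      fin_cases i
      exacts [e.2.1, e.2.2]
    · obtain ⟨-, rfl, e⟩ := e
      congr 1
      funext i
      fin_cases i
      exact e
  | imp φ₁ φ₂ h1 h2 =>
    rcases ψ with _ | _ | ⟨_ | _, _⟩ | _ | _ <;> simp only [formulaCode, Nat.pair_eq_pair] at e <;>
      try omega
    rw [h1 e.2.1, h2 e.2.2]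
  | all φ h =>
    rcases ψ with _ | _ | ⟨_ | _, _⟩ | _ | _ <;> simp only [formulaCode, Nat.pair_eq_pair] at e <;>
      try omega
    rw [h e.2]

/-! Halting of a two-counter machine is reduced to the occurrence of one letter in a PD0L word. Each
counter holds a numeral in base `b`, so popping and pushing digits simulates the two halves of a
Turing tape.

The system has `b` morphisms, so a letter sees its position modulo `b` and nothing else. The
iterates of the start word extend one another, and each appended block is the image of the previous
one. Every second block spells a configuration: counter values in unary, then a marker carrying the
state. The counter to be popped uses units of length one, everything else units of length `b`, and
the block starts at a multiple of `b`. Hence residues count the popped counter: keeping every `b`-th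
unit divides it by `b`, and the marker sits at the residue `d` of the popped digit. The next block
starts at residue `d` and has all its units of length `b`, so each of its significant letters reads
the same `d` and can pass to state `next d`. Two applications thus make one step
(`IsPopBlock.imageFrom`), and `halt` is emitted exactly when the machine stops
(`eval_dom_iff_halt_mem`).

A fixed machine with undecidable halting problem (`exists_undecidable`) fixes the alphabet and the
sentence; the input enters only through the image of `start`. No image is empty, so non-erasing
systems suffice. -/

open Turing

/-! ### Digit machines and the morphisms that simulate them -/

/-- A machine with finite control and two counters that serve as stacks of digits in base `b`. In
state `q` it halts if `act q = none`; if `act q = some (σ, a, next)`, it pops the last digit `d` of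
counter `σ`, pushes `a` on the other counter and goes to state `next d`. -/
structure DigitMachine (Q : Type) where
  b : ℕ
  b_pos : 0 < b
  act : Q → Option (Bool × ℕ × (ℕ → Q))

namespace DigitMachine

variable {Q : Type}

/-- The step function on configurations. -/
def step (M : DigitMachine Q) (c : Q × (Bool → ℕ)) : Option (Q × (Bool → ℕ)) :=
  (M.act c.1).map fun r =>
    (r.2.2 (c.2 r.1 % M.b), fun τ => if τ = r.1 then c.2 τ / M.b else M.b * c.2 τ + r.2.1)

/-- The letters of the PD0L system that simulates a machine with state set `Q`. The Boolean
in `unary` and `marker` tells blocks in which a digit has yet to be popped (`false`) from blocks in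
which the popped digit has yet to be read (`true`). -/
inductive Letter (Q : Type)
  | start : Letter Q
  | filler : Letter Q
  | halt : Letter Q
  | unary (read : Bool) (q : Q) (side : Bool) : Letter Q
  | marker (read : Bool) (q : Q) : Letter Q

namespace Letter

instance [Finite Q] : Finite (Letter Q) := by
  let f : Letter Q → Fin 3 ⊕ (Bool × Q × Bool) ⊕ (Bool × Q)
    | start => .inl 0
    | filler => .inl 1
    | halt => .inl 2
    | unary r q τ => .inr (.inl (r, q, τ))
    | marker r q => .inr (.inr (r, q))
  refine Finite.of_injective f fun x y e => ?_
  cases x <;> cases y <;> simp_all [f]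

end Letter

open Letter

variable (M : DigitMachine Q)

/-- A word of `n` fillers. -/
abbrev fillers (n : ℕ) : List (Letter Q) := List.replicate n filler

/-- A letter padded with fillers to a word of length `b`. -/
def pad (x : Letter Q) : List (Letter Q) := x :: fillers (M.b - 1)

/-- The word that represents one unit of counter `τ` in a block in which a digit has yet to be
popped: it has length one if the digit is popped from `τ`, and length `b` otherwise. -/
def popUnit (q : Q) (τ : Bool) : List (Letter Q) :=
  if (M.act q).map Prod.fst = some τ then [unary false q τ] else M.pad (unary false q τ)

/-- The word that represents one unit of counter `τ` in a block in which the popped digit has yet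
to be read. -/
def readUnit (q : Q) (τ : Bool) : List (Letter Q) := M.pad (unary true q τ)

/-- The image of a letter at a position congruent to `i` modulo `b`. -/
def image (B : List (Letter Q)) (i : ℕ) : Letter Q → List (Letter Q)
  | start => M.pad start ++ B
  | filler => fillers M.b
  | halt => fillers M.b
  | unary false q τ =>
    match M.act q with
    | none => fillers M.b
    | some (σ, _, _) =>
      -- Only every `b`-th unit of the popped counter survives, while each unit of the other counter
      -- yields `b` units.
      if τ = σ then (if i + 1 = M.b then M.readUnit q τ else fillers M.b)
      else (List.replicate M.b (M.readUnit q τ)).flatten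
  | marker false q =>
    match M.act q with
    | none => [halt]
    | some (σ, a, _) =>
      -- The marker's residue `i` is the popped digit; the `b - i` fillers bring the block after
      -- next back to residue `0`.
      (List.replicate a (M.readUnit q !σ)).flatten ++ M.pad (marker true q) ++ fillers (M.b - i)
  | unary true q τ =>
    match M.act q with
    | none => fillers M.b
    | some (_, _, next) => M.popUnit (next i) τ
  | marker true q =>
    match M.act q with
    | none => fillers M.b
    | some (_, _, next) => M.pad (marker false (next i))

/-- The concatenation of the images of the letters of a word that starts at position `o`. -/
def imageFrom (B : List (Letter Q)) : ℕ → List (Letter Q) → List (Letter Q)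
  | _, [] => []
  | o, x :: w => M.image B (o % M.b) x ++ imageFrom B (o + 1) w

variable {M} {B : List (Letter Q)}

theorem fillers_b_ne_nil : fillers (Q := Q) M.b ≠ [] := by
  simpa [fillers] using M.b_pos.ne'

theorem pad_length (x : Letter Q) : (M.pad x).length = M.b := by
  have := M.b_pos
  simp [pad]; omega

theorem popUnit_ne_nil (q : Q) (τ : Bool) : M.popUnit q τ ≠ [] := by
  unfold popUnit; split_ifs <;> simp [pad]

theorem image_ne_nil (i : ℕ) (x : Letter Q) : M.image B i x ≠ [] := by
  rcases x with _ | _ | _ | ⟨_ | _, q, τ⟩ | ⟨_ | _, q⟩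
  · simp [image, pad]
  · exact fillers_b_ne_nil
  · exact fillers_b_ne_nil
  · simp only [image]
    split
    · exact fillers_b_ne_nil
    · have := M.b_pos.ne'
      split_ifs <;> simp [readUnit, pad, this]
  · simp only [image]
    split
    · exact fillers_b_ne_nil
    · exact popUnit_ne_nil _ _
  · simp only [image]
    split <;> simp [pad]
  · simp only [image]
    split
    · exact fillers_b_ne_nil
    · simp [pad]

theorem imageFrom_append (o : ℕ) (u v : List (Letter Q)) :
    M.imageFrom B o (u ++ v) = M.imageFrom B o u ++ M.imageFrom B (o + u.length) v := by
  induction u generalizing o with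
  | nil => simp [imageFrom]
  | cons x u ih => simp [imageFrom, ih, Nat.add_assoc, Nat.add_comm 1]

theorem imageFrom_fillers (o n : ℕ) :
    M.imageFrom B o (fillers n) = fillers (M.b * n) := by
  induction n generalizing o with
  | zero => simp [imageFrom]
  | succ n ih =>
    rw [fillers, List.replicate_succ, imageFrom, ih, image, List.replicate_append_replicate]
    congr 1; ring

theorem imageFrom_pad (o : ℕ) (x : Letter Q) :
    M.imageFrom B o (M.pad x) = M.image B (o % M.b) x ++ fillers (M.b * (M.b - 1)) := by
  rw [pad, imageFrom, imageFrom_fillers]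

variable (M) in
/-- `M.Units unit N w` says that `w` is a product of words `unit τ`, with `N τ` of them for each
`τ`, and of words of `b` fillers. -/
inductive Units (unit : Bool → List (Letter Q)) : (Bool → ℕ) → List (Letter Q) → Prop
  | nil : Units unit 0 []
  | fillers {N w} : Units unit N w → Units unit N (fillers M.b ++ w)
  | unit {N w} (τ : Bool) : Units unit N w → Units unit (N + Pi.single τ 1) (unit τ ++ w)

namespace Units

variable {unit : Bool → List (Letter Q)} {N N' : Bool → ℕ} {u w : List (Letter Q)}

theorem append (hu : M.Units unit N u) (hw : M.Units unit N' w) :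
    M.Units unit (N + N') (u ++ w) := by
  induction hu with
  | nil => simpa
  | fillers _ ih => simpa using ih.fillers
  | unit τ _ ih =>
    rw [List.append_assoc, add_right_comm]
    exact ih.unit τ

theorem fillers_mul (k : ℕ) : M.Units unit 0 (DigitMachine.fillers (M.b * k)) := by
  induction k with
  | zero => exact .nil
  | succ k ih =>
    rw [Nat.mul_succ, Nat.add_comm, DigitMachine.fillers, ← List.replicate_append_replicate]
    exact ih.fillers

theorem replicate (k : ℕ) (τ : Bool) :
    M.Units unit (Pi.single τ k) (List.replicate k (unit τ)).flatten := by
  induction k with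
  | zero => simpa using Units.nil
  | succ k ih =>
    rw [List.replicate_succ, List.flatten_cons, Pi.single_add]
    exact ih.unit τ

theorem halt_notMem (hunit : ∀ τ, halt ∉ unit τ) (h : M.Units unit N w) : halt ∉ w := by
  induction h with
  | nil => simp
  | fillers _ ih => simpa [DigitMachine.fillers] using ih
  | unit τ _ ih => simp [hunit, ih]

end Units

/-! ### One machine step as two applications of the map -/

variable {q : Q} {N : Bool → ℕ} {w : List (Letter Q)} {σ : Bool} {a : ℕ} {next : ℕ → Q}

theorem popUnit_self (hq : M.act q = some (σ, a, next)) :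
    M.popUnit q σ = [unary false q σ] := by
  simp [popUnit, hq]

theorem popUnit_not (hq : M.act q = some (σ, a, next)) :
    M.popUnit q (!σ) = M.pad (unary false q !σ) := by
  simp [popUnit, hq]

theorem halt_notMem_readUnit (τ : Bool) : halt ∉ M.readUnit q τ := by simp [readUnit, pad]

theorem halt_notMem_popUnit (τ : Bool) : halt ∉ M.popUnit q τ := by
  unfold popUnit; split_ifs <;> simp [pad]

theorem Units.pop_length (hq : M.act q = some (σ, a, next)) (h : M.Units (M.popUnit q) N w) :
    w.length ≡ N σ [MOD M.b] := by
  induction h with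
  | nil => exact rfl
  | fillers _ ih => simpa [Nat.ModEq] using ih
  | unit τ _ ih =>
    rcases Bool.eq_or_eq_not τ σ with rfl | rfl
    · simpa [popUnit_self hq, Nat.add_comm] using ih.add_left 1
    · simpa [popUnit_not hq, pad_length, Nat.ModEq] using ih

theorem Units.read_length (h : M.Units (M.readUnit q) N w) : M.b ∣ w.length := by
  induction h with
  | nil => simp
  | fillers _ ih => simpa using ih
  | unit τ _ ih => simpa [readUnit, pad_length] using ih

/-- The offset `o` acts as a running remainder: each unit of `σ` advances it by one and emits a unit
when it wraps around, all other words preserve it modulo `b`. -/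
theorem Units.imageFrom_pop (hq : M.act q = some (σ, a, next)) (h : M.Units (M.popUnit q) N w)
    (o : ℕ) : ∃ N', M.Units (M.readUnit q) N' (M.imageFrom B o w) ∧
      N' σ = (o % M.b + N σ) / M.b ∧ N' (!σ) = M.b * N (!σ) := by
  have hb := M.b_pos
  induction h generalizing o with
  | nil => exact ⟨0, .nil, by simp [Nat.div_eq_of_lt (Nat.mod_lt o hb)], by simp⟩
  | fillers _ ih =>
    obtain ⟨N', h, h1, h2⟩ := ih (o + M.b)
    refine ⟨0 + N', ?_, by simpa using h1, by simpa using h2⟩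
    rw [imageFrom_append, imageFrom_fillers, List.length_replicate]
    exact (Units.fillers_mul M.b).append h
  | unit τ _ ih =>
    rcases Bool.eq_or_eq_not τ σ with rfl | rfl
    · obtain ⟨N', h, h1, h2⟩ := ih (o + 1)
      rw [popUnit_self hq, imageFrom_append]
      simp only [imageFrom, image, hq, List.append_nil, List.length_singleton, if_true]
      have hm := Nat.mod_lt o hb
      split_ifs with ho
      · refine ⟨_, h.unit τ, ?_, by simpa using h2⟩
        have : (o + 1) % M.b = 0 := by rw [← Nat.mod_add_mod, ho, Nat.mod_self]
        simp only [Pi.add_apply, Pi.single_eq_same, h1, this, Nat.zero_add]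
        rw [← Nat.add_div_right _ hb]
        congr 1; omega
      · refine ⟨_, h.fillers, ?_, by simpa using h2⟩
        have : (o + 1) % M.b = o % M.b + 1 := by
          rw [← Nat.mod_add_mod, Nat.mod_eq_of_lt]; omega
        simp only [Pi.add_apply, Pi.single_eq_same, h1, this]
        congr 1; omega
    · obtain ⟨N', h, h1, h2⟩ := ih (o + M.b)
      rw [popUnit_not hq, imageFrom_append, imageFrom_pad, pad_length]
      simp only [image, hq, Bool.not_eq_self, if_false]
      refine ⟨_, ((Units.replicate M.b _).append (Units.fillers_mul _)).append h, ?_, ?_⟩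
      · simpa using h1
      · simp [h2]; ring

/-- All units have length `b`, so their leading letters share the residue of `o` and agree on the
next state. -/
theorem Units.imageFrom_read (hq : M.act q = some (σ, a, next)) (h : M.Units (M.readUnit q) N w)
    (o : ℕ) : M.Units (M.popUnit (next (o % M.b))) N (M.imageFrom B o w) := by
  induction h generalizing o with
  | nil => exact .nil
  | fillers _ ih =>
    rw [imageFrom_append, imageFrom_fillers, List.length_replicate]
    simpa using (Units.fillers_mul M.b).append (ih (o + M.b))
  | @unit N w τ _ ih =>
    rw [imageFrom_append, readUnit, imageFrom_pad, pad_length, List.append_assoc]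
    simp only [image, hq]
    have := (Units.fillers_mul (M.b - 1)).append (ih (o + M.b))
    rw [Nat.add_mod_right, zero_add] at this
    exact this.unit τ

variable (M) in
/-- The block `v` represents the configuration `c`. -/
def IsPopBlock (c : Q × (Bool → ℕ)) (v : List (Letter Q)) : Prop :=
  -- With `b ∣ t + 1`, the marker and its fillers do not change the length modulo `b`.
  ∃ u t, v = u ++ marker false c.1 :: fillers t ∧ M.Units (M.popUnit c.1) c.2 u ∧ M.b ∣ t + 1

theorem IsPopBlock.halt_notMem {c : Q × (Bool → ℕ)} {v : List (Letter Q)}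
    (h : M.IsPopBlock c v) : halt ∉ v := by
  obtain ⟨u, t, rfl, h, -⟩ := h
  simp [h.halt_notMem halt_notMem_popUnit]

theorem IsPopBlock.halt_mem {c : Q × (Bool → ℕ)} {v : List (Letter Q)}
    (h : M.IsPopBlock c v) (hc : M.step c = none) (o : ℕ) : halt ∈ M.imageFrom B o v := by
  obtain ⟨u, t, rfl, h, -⟩ := h
  have hc : M.act c.1 = none := by simpa [step] using hc
  simp [imageFrom_append, imageFrom, image, hc]

/-- The popped digit is seen twice: as the marker's residue, then as the starting residue of the
intermediate block. The second conclusion restores the alignment for the next step. -/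
theorem IsPopBlock.imageFrom {c c' : Q × (Bool → ℕ)} {v : List (Letter Q)} {o : ℕ}
    (h : M.IsPopBlock c v) (hc : M.step c = some c') (ho : M.b ∣ o) :
    halt ∉ M.imageFrom B o v ∧
    M.b ∣ o + v.length + (M.imageFrom B o v).length ∧
    M.IsPopBlock c' (M.imageFrom B (o + v.length) (M.imageFrom B o v)) := by
  obtain ⟨u, t, rfl, h, ht⟩ := h
  obtain ⟨q, N⟩ := c
  simp only [step, Option.map_eq_some_iff] at hc
  obtain ⟨⟨σ, a, next⟩, hq, rfl⟩ := hc
  dsimp only at hq h ⊢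
  have hb := M.b_pos
  obtain ⟨N', h', h1, h2⟩ := h.imageFrom_pop (B := B) hq o
  have hd : (o + u.length) % M.b = N σ % M.b := by
    rw [Nat.add_mod, Nat.mod_eq_zero_of_dvd ho, zero_add, Nat.mod_mod, h.pop_length hq]
  have hlt := Nat.mod_lt (N σ) hb
  have hv : M.imageFrom B o (u ++ marker false q :: fillers t) =
      (M.imageFrom B o u ++ (List.replicate a (M.readUnit q !σ)).flatten) ++ marker true q ::
        fillers (M.b - 1 + (M.b - N σ % M.b) + M.b * t) := by
    simp only [imageFrom_append, DigitMachine.imageFrom, hd, image, hq, imageFrom_fillers, pad,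
      List.append_assoc, List.cons_append, List.replicate_append_replicate, Nat.add_assoc]
  have hu := h'.append (Units.replicate (unit := M.readUnit q) (M := M) a !σ)
  have hl := hu.read_length
  have hd' : (o + (u ++ marker false q :: fillers t).length) % M.b = N σ % M.b := by
    rw [List.length_append, List.length_cons, List.length_replicate, ← Nat.add_assoc, Nat.add_mod,
      Nat.mod_eq_zero_of_dvd ht, hd]
    simp
  generalize o + (u ++ marker false q :: fillers t).length = o' at hd'
  rw [hv]
  generalize M.imageFrom B o u ++ (List.replicate a (M.readUnit q !σ)).flatten = u' at *
  refine ⟨by simp [hu.halt_notMem halt_notMem_readUnit], ?_, ?_⟩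
  · obtain ⟨k, hk⟩ := hl
    have e := Nat.div_add_mod o' M.b
    rw [hd'] at e
    -- With `d` the popped digit, `o'` contributes `d` beyond a multiple of `b`, and the marker with
    -- its fillers has length `2 * b - d + b * t`.
    refine ⟨o' / M.b + k + 2 + t, ?_⟩
    simp only [List.length_append, List.length_cons, List.length_replicate, hk, Nat.mul_add]
    omega
  · obtain ⟨k, hk⟩ := hl
    refine ⟨M.imageFrom B o' u', M.b - 1 + M.b * (M.b - 1 + (M.b - N σ % M.b) + M.b * t),
      ?_, ?_, ?_⟩
    · rw [imageFrom_append, DigitMachine.imageFrom, imageFrom_fillers]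
      simp only [image, hq, pad, hk, Nat.add_mul_mod_self_left, hd', List.cons_append,
        List.replicate_append_replicate]
    · have := hu.imageFrom_read (B := B) hq o'
      rw [hd'] at this
      convert this using 1
      funext τ
      rcases Bool.eq_or_eq_not τ σ with rfl | rfl
      · simp [h1, Nat.mod_eq_zero_of_dvd ho]
      · simp [h2]
    · refine ⟨1 + (M.b - 1 + (M.b - N σ % M.b) + M.b * t), ?_⟩
      rw [Nat.mul_add M.b 1]
      generalize M.b * (M.b - 1 + (M.b - N σ % M.b) + M.b * t) = x
      omega

/-! ### Iterates of the start word and halting -/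

variable (M)

/-- The word that represents the configuration with state `q`, counter `true` equal to `n` and the
other counter equal to `0`. -/
def initBlock (q : Q) (n : ℕ) : List (Letter Q) :=
  (List.replicate n (M.popUnit q true)).flatten ++ M.pad (marker false q)

/-- The iterates of the map of the PD0L system on its start word. -/
def words (B : List (Letter Q)) (j : ℕ) : List (Letter Q) :=
  (M.imageFrom B 0)^[j] (M.pad start)

variable {M}

theorem words_succ (j : ℕ) : M.words B (j + 1) = M.imageFrom B 0 (M.words B j) :=
  Function.iterate_succ_apply' ..

theorem words_one : M.words B 1 = M.words B 0 ++ (B ++ fillers (M.b * (M.b - 1))) := by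
  rw [words_succ, words, Function.iterate_zero_apply, imageFrom_pad, image, List.append_assoc]

theorem words_prefix (j : ℕ) : M.words B j <+: M.words B (j + 1) := by
  induction j with
  | zero => exact ⟨_, words_one.symm⟩
  | succ j ih =>
    obtain ⟨v, hv⟩ := ih
    exact ⟨M.imageFrom B (0 + (M.words B j).length) v,
      by rw [words_succ (j := j + 1), ← hv, imageFrom_append, ← words_succ, hv]⟩

theorem words_prefix_of_le {i j : ℕ} (h : i ≤ j) : M.words B i <+: M.words B j := by
  induction j, h using Nat.le_induction with
  | base => exact List.prefix_rfl
  | succ j _ ih => exact ih.trans (words_prefix j)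

theorem words_add_two {j : ℕ} {v : List (Letter Q)} (h : M.words B (j + 1) = M.words B j ++ v) :
    M.words B (j + 2) = M.words B (j + 1) ++ M.imageFrom B (M.words B j).length v := by
  rw [words_succ, h, imageFrom_append, ← words_succ, h, Nat.zero_add]

theorem initBlock_isPopBlock (q : Q) (n : ℕ) :
    M.IsPopBlock (q, Pi.single true n) (M.initBlock q n ++ fillers (M.b * (M.b - 1))) := by
  refine ⟨_, M.b - 1 + M.b * (M.b - 1), ?_, Units.replicate n true, 1 + (M.b - 1), ?_⟩
  · simp [initBlock, pad, List.replicate_append_replicate]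
  · have := M.b_pos
    rw [Nat.mul_add]; omega

variable {q : Q} {n : ℕ} {c c' : Q × (Bool → ℕ)}

/-- The `j`-th iterate is followed by a block that represents `c`. -/
def Simulates (M : DigitMachine Q) (B : List (Letter Q)) (j : ℕ) (c : Q × (Bool → ℕ)) : Prop :=
  M.b ∣ (M.words B j).length ∧ ∃ v, M.words B (j + 1) = M.words B j ++ v ∧ M.IsPopBlock c v

theorem Simulates.init : M.Simulates (M.initBlock q n) 0 (q, Pi.single true n) :=
  ⟨by simp [words, pad_length], _, words_one, initBlock_isPopBlock q n⟩

theorem Simulates.step {j : ℕ} (h : M.Simulates B j c) (hc : M.step c = some c') :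
    M.Simulates B (j + 2) c' ∧ (halt ∉ M.words B j → halt ∉ M.words B (j + 2)) := by
  obtain ⟨hb, v, hv, hB⟩ := h
  obtain ⟨h1, h2, h3⟩ := hB.imageFrom (B := B) hc hb
  have e := words_add_two hv
  refine ⟨⟨?_, _, words_add_two e, ?_⟩, fun hj => ?_⟩
  · rw [e, hv]
    simpa [Nat.add_assoc] using h2
  · rw [hv, List.length_append]
    exact h3
  · rw [e, hv]
    simp [hj, hB.halt_notMem, h1]

theorem Simulates.halt_mem {j : ℕ} (h : M.Simulates B j c) (hc : M.step c = none) :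
    halt ∈ M.words B (j + 2) := by
  obtain ⟨-, v, hv, hB⟩ := h
  rw [words_add_two hv]
  exact List.mem_append_right _ (hB.halt_mem hc _)

theorem eval_dom_iff_halt_mem :
    (StateTransition.eval M.step (q, Pi.single true n)).Dom ↔
      ∃ j, halt ∈ M.words (M.initBlock q n) j := by
  constructor
  · intro h
    obtain ⟨hr, hc⟩ := StateTransition.mem_eval.1 (Part.get_mem h)
    generalize Part.get _ h = c at hr hc
    suffices ∃ j, M.Simulates (M.initBlock q n) j c from
      this.elim fun j hj => ⟨_, hj.halt_mem hc⟩
    clear hc h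
    induction hr with
    | refl => exact ⟨0, .init⟩
    | tail _ hs ih => exact ih.elim fun j hj => ⟨_, (hj.step hs).1⟩
  · rintro ⟨j, hj⟩
    by_contra hdom
    -- A computation that never halts keeps the even iterates free of `halt`; iterate `j` is a
    -- prefix of iterate `2 * j`.
    have key : ∀ k, ∃ c, StateTransition.Reaches M.step (q, Pi.single true n) c ∧
        M.Simulates (M.initBlock q n) (2 * k) c ∧ halt ∉ M.words (M.initBlock q n) (2 * k) := by
      intro k
      induction k with
      | zero => exact ⟨_, .refl, .init, by simp [words, pad]⟩
      | succ k ih =>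
        obtain ⟨c, hr, hs, hh⟩ := ih
        rcases hc : M.step c with _ | c'
        · exact absurd (Part.dom_iff_mem.2 ⟨c, StateTransition.mem_eval.2 ⟨hr, hc⟩⟩) hdom
        · exact ⟨c', hr.tail hc, (hs.step hc).1, (hs.step hc).2 hh⟩
    obtain ⟨_, _, _, h⟩ := key j
    exact h ((words_prefix_of_le (by omega)).subset hj)

end DigitMachine

/-! ### Turing machines as digit machines -/

namespace Turing.ListBlank

variable {Γ : Type} [Inhabited Γ]

/-- The digits of a half-infinite tape, read as a number in base `b`. -/
def value (b : ℕ) (f : Γ → ℕ) (hf : f default = 0) (l : ListBlank Γ) : ℕ :=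
  -- Trailing blanks are leading zeros, so the value is well defined.
  l.liftOn (fun l => Nat.ofDigits b (l.map f)) (by
    rintro l _ ⟨n, rfl⟩
    simp [Nat.ofDigits_append, hf, Nat.ofDigits_replicate_zero])

variable {b : ℕ} {f : Γ → ℕ} (hf : f default = 0)

theorem value_cons (a : Γ) (l : ListBlank Γ) :
    (l.cons a).value b f hf = b * l.value b f hf + f a := by
  induction l using ListBlank.induction_on with | _ l
  change Nat.ofDigits b ((a :: l).map f) = b * Nat.ofDigits b (l.map f) + f a
  rw [List.map_cons, Nat.ofDigits_cons, add_comm]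

theorem value_eq (l : ListBlank Γ) :
    l.value b f hf = b * l.tail.value b f hf + f l.head := by
  rw [← value_cons, ListBlank.cons_head_tail]

theorem value_mod (hb : ∀ a, f a < b) (l : ListBlank Γ) : l.value b f hf % b = f l.head := by
  rw [value_eq, Nat.mul_add_mod, Nat.mod_eq_of_lt (hb _)]

theorem value_div (hb : ∀ a, f a < b) (l : ListBlank Γ) :
    l.value b f hf / b = l.tail.value b f hf := by
  rw [value_eq, Nat.mul_add_div ((Nat.zero_le _).trans_lt (hb default)),
    Nat.div_eq_of_lt (hb _), Nat.add_zero]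

end Turing.ListBlank

namespace DigitMachine

variable {Γ Λ : Type} [Inhabited Γ] [Inhabited Λ]

/-- The states of the machine that simulates a Turing machine: either a label and the scanned symbol,
or an order to move the head in a direction, leaving a given symbol behind, and to enter a label. -/
abbrev TMState (Γ Λ : Type) := (Λ × Γ) ⊕ (Bool × Λ × Γ)

/-- The digit machine that simulates a Turing machine. Counters `false` and `true` hold the parts of
the tape to the left and to the right of the head. To write, it moves right and back. -/
noncomputable def ofTM0 (T : TM0.Machine Γ Λ) (b : ℕ) (hb : 0 < b) (f : Γ → ℕ) :
    DigitMachine (TMState Γ Λ) where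
  b := b
  b_pos := hb
  act
    | .inl (l, a) => (T l a).map fun r =>
      match r.2 with
      | .move .left => (false, f a, fun d => .inl (r.1, Function.invFun f d))
      | .move .right => (true, f a, fun d => .inl (r.1, Function.invFun f d))
      | .write a' => (true, f a', fun d => .inr (false, r.1, Function.invFun f d))
    | .inr (σ, l, a) => some (σ, f a, fun d => .inl (l, Function.invFun f d))

/-- The configuration of the digit machine that represents a configuration of the Turing machine. -/
def ofTM0Cfg (b : ℕ) (f : Γ → ℕ) (hf : f default = 0) (c : TM0.Cfg Γ Λ) :
    TMState Γ Λ × (Bool → ℕ) :=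
  (.inl (c.q, c.Tape.head),
    fun τ => if τ then c.Tape.right.value b f hf else c.Tape.left.value b f hf)

variable {T : TM0.Machine Γ Λ} {b : ℕ} {hb : 0 < b} {f : Γ → ℕ}

theorem ofTM0_respects (hf : f default = 0) (hfb : ∀ a, f a < b) (hi : Function.Injective f) :
    StateTransition.Respects (TM0.step T) (ofTM0 T b hb f).step
      (fun c c' => ofTM0Cfg b f hf c = c') := by
  have hinv := Function.leftInverse_invFun hi
  refine StateTransition.fun_respects.2 fun ⟨l, a, L, R⟩ => ?_
  rcases h : T l a with _ | ⟨l', d | a'⟩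
  · simp [TM0.step, h, StateTransition.FRespects, ofTM0Cfg, step, ofTM0]
  · simp only [TM0.step, h, Option.map_some, StateTransition.FRespects]
    refine .single ?_
    rcases d with _ | _
    all_goals
      simp only [ofTM0Cfg, step, ofTM0, h, Option.map_some, Option.mem_def, Option.some.injEq,
        Prod.mk.injEq]
      refine ⟨?_, ?_⟩
      · simp [Tape.move, ListBlank.value_mod hf hfb, hinv _]
      · funext τ
        cases τ <;> simp [Tape.move, ListBlank.value_div hf hfb, ListBlank.value_cons]
  · simp only [TM0.step, h, Option.map_some, StateTransition.FRespects]
    -- Intermediate configuration: the written symbol lies on the left counter and the state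
    -- remembers the symbol popped from the right; moving back restores both.
    refine .head (b := (.inr (false, l', R.head), fun τ => if τ then R.tail.value b f hf
      else b * L.value b f hf + f a')) ?_ (.single ?_)
    · simp only [ofTM0Cfg, step, ofTM0, h, Option.map_some, Option.mem_def, Option.some.injEq,
        Prod.mk.injEq]
      refine ⟨?_, ?_⟩
      · simp [ListBlank.value_mod hf hfb, hinv _]
      · funext τ
        cases τ <;> simp [ListBlank.value_div hf hfb]
    · simp only [ofTM0Cfg, step, ofTM0, Option.map_some, Option.mem_def, Option.some.injEq,
        Prod.mk.injEq]
      refine ⟨?_, ?_⟩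
      · simp [Tape.write, Nat.mod_eq_of_lt (hfb _), hinv _]
      · funext τ
        cases τ
        · simp [Tape.write, Nat.mul_add_div hb, Nat.div_eq_of_lt (hfb _)]
        · simp [Tape.write, ← ListBlank.value_eq]

/-- The extra initial state pops the first input symbol into the control. It pushes a blank, digit
`0`, which leaves the left counter at `0`. -/
theorem ofTM0_eval_dom (hf : f default = 0) (hfb : ∀ a, f a < b) (hi : Function.Injective f)
    (l : List Γ) :
    (StateTransition.eval (ofTM0 T b hb f).step
      (.inr (true, default, default), Pi.single true (Nat.ofDigits b (l.map f)))).Dom ↔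
      (TM0.eval T l).Dom := by
  have hinv := Function.leftInverse_invFun hi
  have hstep : ofTM0Cfg b f hf (TM0.init l) ∈ (ofTM0 T b hb f).step
      (.inr (true, default, default), Pi.single true (Nat.ofDigits b (l.map f))) := by
    have hv : Nat.ofDigits b (l.map f) = (ListBlank.mk l).value b f hf := rfl
    simp only [ofTM0Cfg, step, ofTM0, Option.map_some, Option.mem_def, Option.some.injEq,
      Prod.mk.injEq, hv, TM0.init, Tape.mk₁, Tape.mk₂, Tape.mk']
    refine ⟨?_, ?_⟩
    · simp [ListBlank.value_mod hf hfb, hinv _]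
    · funext τ
      cases τ
      · simp [hf, ListBlank.value, ListBlank.mk, ListBlank.liftOn]
      · simp [ListBlank.value_div hf hfb]
  rw [StateTransition.reaches_eval (.single hstep)]
  exact StateTransition.tr_eval_dom (ofTM0_respects hf hfb hi) rfl

end DigitMachine

/-! ### From partial recursive functions to an undecidable digit machine -/

/-- A Turing machine whose label type is infinite but which uses only finitely many labels can be
replaced by one with a finite label type. -/
theorem Turing.TM0.exists_finite_eval_dom {Γ Λ : Type} [Inhabited Γ] [Inhabited Λ]
    (T : TM0.Machine Γ Λ) (S : Set Λ) (hS : S.Finite) (hT : TM0.Supports T S) :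
    ∃ (Λ' : Type) (_ : Inhabited Λ') (_ : Finite Λ') (T' : TM0.Machine Γ Λ'),
      ∀ l, (TM0.eval T' l).Dom ↔ (TM0.eval T l).Dom := by
  classical
  let i : Inhabited S := ⟨⟨default, hT.1⟩⟩
  let g : PointedMap Λ S :=
    ⟨fun q => if h : q ∈ S then ⟨q, h⟩ else default, by simp [hT.1]; rfl⟩
  have hg : ∀ q ∈ S, ((g q : S) : Λ) = q := fun q h => by
    change ((if h : q ∈ S then (⟨q, h⟩ : S) else default : S) : Λ) = q
    simp [h]
  refine ⟨S, i, hS.to_subtype, T.map ⟨id, rfl⟩ ⟨id, rfl⟩ g Subtype.val, fun l => ?_⟩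
  refine StateTransition.tr_eval_dom
    (TM0.Machine.map_respects T ⟨id, rfl⟩ ⟨id, rfl⟩ g Subtype.val hT (fun _ => rfl) hg) ⟨hT.1, ?_⟩
  rw [TM0.map_init]
  exact congrArg TM0.init (List.map_id l)

theorem Primrec.nat_bits : Primrec Nat.bits := by
  have h : Primrec₂ fun (_ : Unit) n => Nat.bits n := by
    -- The list holds the values at all smaller arguments, so its length is the current argument.
    refine Primrec.nat_strong_rec _ (g := fun _ l => if l.length = 0 then some [] else
      some (l.length.bodd :: l.getD l.length.div2 [])) ?_ ?_
    · refine Primrec.ite ?_ (Primrec.const _) ?_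
      · exact Primrec.eq.comp (Primrec.list_length.comp Primrec.snd) (Primrec.const 0)
      · have hl : Primrec fun p : Unit × List (List Bool) => p.2.length :=
          Primrec.list_length.comp Primrec.snd
        exact Primrec.option_some.comp (Primrec.list_cons.comp (Primrec.nat_bodd.comp hl)
          ((Primrec.list_getD []).comp Primrec.snd (Primrec.nat_div2.comp hl)))
    · intro _ n
      rcases Nat.eq_zero_or_pos n with rfl | hn
      · simp
      · have h2 : n.div2 < n := by rw [Nat.div2_val]; omega
        have e : n.bits = n.bodd :: n.div2.bits := by
          conv_lhs => rw [← Nat.bit_bodd_div2 n]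
          refine Nat.bits_append_bit _ _ fun h0 => ?_
          have := Nat.bit_bodd_div2 n
          rw [h0] at this
          cases hb : n.bodd
          · simp [hb] at this; omega
          · rfl
        simp [hn.ne', h2, e]
  exact h.comp (Primrec.const ()) Primrec.id

theorem Primrec.ofDigits_reverse_bits (b d : ℕ) (g : Bool → ℕ) :
    Primrec fun n : ℕ => Nat.ofDigits b (d :: (n.bits.map g).reverse) := by
  simp only [Nat.ofDigits_eq_foldr]
  refine Primrec.nat_add.comp (Primrec.const _) (Primrec.nat_mul.comp (Primrec.const _) ?_)
  exact Primrec.list_foldr (h := fun _ p => p.1 + b * p.2)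
    (Primrec.list_reverse.comp (Primrec.list_map Primrec.nat_bits
      ((Primrec.dom_finite g).comp Primrec.snd).to₂)) (Primrec.const 0)
    (Primrec.nat_add.comp (Primrec.fst.comp Primrec.snd)
      (Primrec.nat_mul.comp (Primrec.const b) (Primrec.snd.comp Primrec.snd)))

namespace Turing.PartrecToTM2

theorem trNat_eq_bits (n : ℕ) :
    trNat n = n.bits.map fun x => cond x Γ'.bit1 Γ'.bit0 := by
  have h (p : PosNum) : trPosNum p = (p : ℕ).bits.map fun x => cond x Γ'.bit1 Γ'.bit0 := by
    induction p with
    | one => simp [trPosNum]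
    | bit0 p ih =>
      rw [trPosNum, ih, PosNum.cast_bit0, ← two_mul, Nat.bit0_bits _ (PosNum.to_nat_pos p).ne']
      rfl
    | bit1 p ih =>
      rw [trPosNum, ih, PosNum.cast_bit1, ← two_mul, Nat.bit1_bits]
      rfl
  rw [trNat]
  conv_rhs => rw [← Num.to_of_nat n]
  cases (n : Num) with
  | zero => simp [trNum]
  | pos p => exact h p

instance : Fintype K' := ⟨{.main, .rev, .aux, .stack}, fun k => by cases k <;> simp⟩

end Turing.PartrecToTM2

open Turing.PartrecToTM2 in
/-- Every unary partial recursive function has the domain of a finite Turing machine, with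
a primitive recursive encoding of the arguments on the tape. -/
theorem Turing.TM0.exists_eval_dom {p : ℕ →. ℕ} (hp : Partrec p) :
    ∃ (Γ Λ : Type) (_ : Inhabited Γ) (_ : Inhabited Λ) (_ : Finite Γ) (_ : Finite Λ)
      (T : TM0.Machine Γ Λ) (enc : ℕ → List Γ), (∀ n, (TM0.eval T (enc n)).Dom ↔ (p n).Dom) ∧
        ∀ (b : ℕ) (f : Γ → ℕ), Primrec fun n => Nat.ofDigits b ((enc n).map f) := by
  obtain ⟨c, hc⟩ := ToPartrec.Code.exists_code (Nat.Partrec'.part_iff₁.2 hp)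
  let iΛ : Inhabited PartrecToTM2.Λ' := ⟨trNormal c Cont'.halt⟩
  let M : PartrecToTM2.Λ' → TM2.Stmt (fun _ : K' => PartrecToTM2.Γ') PartrecToTM2.Λ'
    (Option PartrecToTM2.Γ') := PartrecToTM2.tr
  have h2 := TM2to1.tr_supports M (tr_supports c Cont'.halt)
  have h1 := TM1to0.tr_supports _ h2
  obtain ⟨Λ, hΛ, hfin, T, hT⟩ := TM0.exists_finite_eval_dom _ _ (Finset.finite_toSet _) h1
  let blank : ∀ _ : K', Option PartrecToTM2.Γ' := fun _ => none
  let sym (x : PartrecToTM2.Γ') : TM2to1.Γ' K' (fun _ => PartrecToTM2.Γ') :=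
    (false, Function.update blank K'.main (some x))
  refine ⟨TM2to1.Γ' K' (fun _ => PartrecToTM2.Γ'), Λ, inferInstance, hΛ, inferInstance, hfin, T,
    fun n => TM2to1.trInit K'.main (trList [n]), fun n => ?_, fun b f => ?_⟩
  · refine (hT _).trans ?_
    rw [TM1to0.tr_eval, TM2to1.tr_eval_dom M]
    have e : (TM2.init K'.main (trList [n]) : TM2.Cfg (fun _ : K' => PartrecToTM2.Γ')
        PartrecToTM2.Λ' (Option PartrecToTM2.Γ')) = PartrecToTM2.init c [n] := by
      rw [TM2.init, PartrecToTM2.init]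
      congr 1
      funext k
      cases k <;> rfl
    have : (TM2.eval M K'.main (trList [n])).Dom ↔ (c.eval [n]).Dom := by
      change (StateTransition.eval (TM2.step M) (TM2.init K'.main (trList [n]))).Dom ↔ _
      rw [e]
      change (StateTransition.eval (TM2.step PartrecToTM2.tr) (PartrecToTM2.init c [n])).Dom ↔ _
      rw [PartrecToTM2.tr_eval]
      rfl
    rw [this]
    have := hc (n ::ᵥ List.Vector.nil)
    simp only [List.Vector.head_cons] at this
    change (c.eval [n]) = _ at this
    rw [this]
    rfl
  · have e (n : ℕ) : (TM2to1.trInit K'.main (trList [n])).map f = f (true, (sym .cons).2) ::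
        (n.bits.map fun x => f (sym (cond x .bit1 .bit0))).reverse := by
      have h : (trList [n]).reverse = .cons :: (n.bits.map fun x => cond x .bit1 .bit0).reverse := by
        simp [trList, trNat_eq_bits]
      have h' := congrArg (fun L' => (true, (L'.map sym).headI.2) :: (L'.map sym).tail) h
      refine (congrArg (List.map f) h').trans ?_
      simp only [List.map_cons, List.headI_cons, List.tail_cons, List.map_reverse, List.map_map]
      exact congrArg (List.cons _) (List.map_reverse.trans (congrArg List.reverse List.map_map))
    simp only [e]
    exact Primrec.ofDigits_reverse_bits b _ _

open Nat.Partrec in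
/-- There is a digit machine with finitely many states whose halting problem is undecidable. -/
theorem DigitMachine.exists_undecidable :
    ∃ (Q : Type) (_ : Finite Q) (M : DigitMachine Q) (q : Q) (g : ℕ → ℕ), Primrec g ∧
      ¬ ComputablePred fun n => (StateTransition.eval M.step (q, Pi.single true (g n))).Dom := by
  have hp : _root_.Partrec fun n : ℕ => (Denumerable.ofNat Code n).eval 0 :=
    Code.eval_part.comp (Computable.ofNat Code) (Computable.const 0)
  obtain ⟨Γ, Λ, _, _, _, _, T, enc, henc, hprim⟩ := Turing.TM0.exists_eval_dom hp
  obtain ⟨b, ⟨e⟩⟩ := Finite.exists_equiv_fin Γ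
  have hb : 0 < b := (Nat.zero_le _).trans_lt (e default).2
  -- The swap gives the blank symbol the digit `0`.
  let e' := e.trans (Equiv.swap (e default) ⟨0, hb⟩)
  let f : Γ → ℕ := fun a => (e' a).val
  have hf : f default = 0 := by simp [f, e']
  have hi : Function.Injective f := Fin.val_injective.comp e'.injective
  refine ⟨_, inferInstance, ofTM0 T b hb f, .inr (true, default, default), _, hprim b f, fun h => ?_⟩
  refine ComputablePred.halting_problem 0 ?_
  have h' : ComputablePred fun n : ℕ => ((Denumerable.ofNat Code n).eval 0).Dom :=
    h.of_eq fun n => (ofTM0_eval_dom hf (fun a => (e' a).2) hi _).trans (henc n)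
  obtain ⟨_, h'⟩ := h'
  refine ⟨fun c => decidable_of_iff (((Denumerable.ofNat Code (Encodable.encode c)).eval 0).Dom)
    (by simp), (h'.comp Computable.encode).of_eq fun c => ?_⟩
  simp

/-! ### The PD0L system, its limit word and its computability -/

namespace DigitMachine

open Letter

variable {Q : Type} {M : DigitMachine Q} {B : List (Letter Q)} {n : ℕ}

theorem length_le_imageFrom (o : ℕ) (w : List (Letter Q)) :
    w.length ≤ (M.imageFrom B o w).length := by
  induction w generalizing o with
  | nil => simp
  | cons x w ih =>
    have := List.length_pos_of_ne_nil (image_ne_nil (M := M) (B := B) (o % M.b) x)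
    have := ih (o + 1)
    rw [imageFrom, List.length_append, List.length_cons]
    omega

/-- The leading `start` reproduces itself and adds `B`, while no other letter is erased. -/
theorem lt_length_words (hB : B ≠ []) (j : ℕ) : j < (M.words B j).length := by
  induction j with
  | zero => simp [words, pad]
  | succ j ih =>
    obtain ⟨t, ht⟩ := words_prefix_of_le (M := M) (B := B) (Nat.zero_le j)
    rw [words, Function.iterate_zero_apply, pad, List.cons_append] at ht
    have hl := length_le_imageFrom (M := M) (B := B) (0 + 1) (fillers (M.b - 1) ++ t)
    have := List.length_pos_of_ne_nil hB
    rw [← ht, List.length_cons] at ih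
    rw [words_succ, ← ht, imageFrom, image, pad]
    simp only [List.length_append, List.length_cons] at *
    omega

theorem periodicMap_map (e : Letter Q ≃ Fin n) (w : List (Letter Q)) :
    periodicMap M.b_pos (fun i a => (M.image B i (e.symm a)).map e) (w.map e) =
      (M.imageFrom B 0 w).map e := by
  suffices ∀ o, ((w.map e).mapIdx fun i a =>
      (M.image B ((o + i) % M.b) (e.symm a)).map e).flatten = (M.imageFrom B o w).map e by
    simpa [periodicMap] using this 0
  induction w with
  | nil => simp [imageFrom]
  | cons x w ih =>
    intro o
    rw [imageFrom, List.map_append, ← ih]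
    simp [List.mapIdx_cons, Nat.add_assoc, Nat.add_comm 1]

/-- The PD0L system that simulates the machine, with letters numbered by `e`. -/
def system (M : DigitMachine Q) (B : List (Letter Q)) (e : Letter Q ≃ Fin n) :
    PD0LSystem (Fin n) where
  p := M.b
  p_pos := M.b_pos
  h i a := (M.image B i (e.symm a)).map e
  s := (M.pad start).map e
  s_prefix := by
    rw [periodicMap_map]
    exact (words_prefix (M := M) (B := B) 0).map e

variable {e : Letter Q ≃ Fin n}

theorem system_nonErasing : (M.system B e).NonErasing := fun i a => by
  simpa [system] using image_ne_nil _ _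

theorem system_iterate (j : ℕ) :
    (M.system B e).H^[j] (M.system B e).s = (M.words B j).map e := by
  induction j with
  | zero => rfl
  | succ j ih =>
    rw [Function.iterate_succ_apply', ih, words_succ, ← periodicMap_map]
    rfl

/-- The limit of the words `M.words B j`. -/
noncomputable def limitWord (M : DigitMachine Q) (B : List (Letter Q)) (k : ℕ) : Letter Q :=
  (M.words B k).getD k start

theorem getElem?_words (hB : B ≠ []) {j k : ℕ} (h : k < (M.words B j).length) :
    (M.words B j)[k] = M.limitWord B k := by
  have hk := lt_length_words (M := M) hB k
  rw [limitWord, List.getD_eq_getElem _ _ hk]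
  rcases le_total j k with hjk | hjk
  · exact (words_prefix_of_le hjk).getElem h
  · exact ((words_prefix_of_le hjk).getElem hk).symm

theorem system_generates (hB : B ≠ []) :
    (M.system B e).Generates fun k => e (M.limitWord B k) := by
  refine fun k => ⟨k, fun i hi => ?_⟩
  rw [system_iterate]
  have hlt := hi.trans_lt (lt_length_words (M := M) hB i)
  rw [List.prefix_iff_eq_take]
  refine List.ext_getElem (by simp; omega) fun m h1 h2 => ?_
  simp [getElem?_words hB]

theorem exists_limitWord_eq (hB : B ≠ []) (a : Letter Q) :
    (∃ k, M.limitWord B k = a) ↔ ∃ j, a ∈ M.words B j := by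
  constructor
  · rintro ⟨k, rfl⟩
    have hk := lt_length_words (M := M) hB k
    exact ⟨k, getElem?_words hB hk ▸ List.getElem_mem hk⟩
  · rintro ⟨j, hj⟩
    obtain ⟨k, hk, rfl⟩ := List.mem_iff_getElem.1 hj
    exact ⟨k, (getElem?_words hB hk).symm⟩

theorem primrec_flatten_replicate {g : ℕ → ℕ} (hg : Primrec g) (u : List ℕ) :
    Primrec fun m => (List.replicate (g m) u).flatten := by
  refine (Primrec.list_flatMap (Primrec.list_range.comp hg) (Primrec.const u).to₂).of_eq fun m => ?_
  simp [List.flatMap_def, List.map_const']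

theorem image_eq_of_ne_start (B' : List (Letter Q)) (i : ℕ) {x : Letter Q} (hx : x ≠ start) :
    M.image B i x = M.image B' i x := by
  rcases x with _ | _ | _ | ⟨_ | _, _, _⟩ | ⟨_ | _, _⟩
  · exact absurd rfl hx
  all_goals rfl

/-- Only the image of `start` varies with the input, and there only through a number of repetitions.
-/
theorem primrec_image_initBlock {g : ℕ → ℕ} (hg : Primrec g) (q : Q) (F : Letter Q → ℕ) (i : ℕ)
    (x : Letter Q) : Primrec fun m => (M.image (M.initBlock q (g m)) i x).map F := by
  by_cases hx : x = start
  · subst hx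
    simp only [image, initBlock, List.map_append, List.map_flatten, List.map_replicate]
    exact Primrec.list_append.comp (Primrec.const _)
      (Primrec.list_append.comp (primrec_flatten_replicate hg _) (Primrec.const _))
  · exact (Primrec.const ((M.image [] i x).map F)).of_eq fun m => by
      rw [image_eq_of_ne_start (M.initBlock q (g m)) i hx]

theorem primrec_code_system {g : ℕ → ℕ} (hg : Primrec g) (q : Q) :
    Primrec fun m => (M.system (M.initBlock q (g m)) e).code := by
  have h (i : Fin M.b) (a : Fin n) : Primrec fun m =>
      ((M.image (M.initBlock q (g m)) i (e.symm a)).map e).map Fin.val := by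
    simp only [List.map_map]
    exact primrec_image_initBlock hg q _ i _
  exact (Primrec.const n).pair
    ((Primrec.list_ofFn fun i => Primrec.list_ofFn fun a => h i a).pair (Primrec.const _))

end DigitMachine

/-! ### The sentence and the reduction -/

/-- The sentence that says that the letter `a` occurs. -/
def occursSentence {A : Type} (a : A) : (wordLanguage A).Sentence :=
  (Language.Relations.boundedFormula₁ (L := wordLanguage A) (WordRel.letter a)
    (Language.Term.var (.inr (0 : Fin 1)))).ex

theorem wordSatisfies_occursSentence {A : Type} (x : ℕ → A) (a : A) :
    WordSatisfies x (occursSentence a) ↔ ∃ k, x k = a := by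
  let _ := wordStructure x
  unfold WordSatisfies occursSentence Language.Sentence.Realize Language.Formula.Realize
  rw [Language.BoundedFormula.realize_ex]
  refine exists_congr fun k => ?_
  exact Iff.rfl

/-- There is no algorithm that, given a PD0L system with non-erasing morphisms that generates an
infinite word `x`, and given a first-order sentence `φ` in the order of positions and the letter
predicates, decides whether `φ` belongs to the first-order theory of `x`. -/
theorem mainTheorem7 :
    ¬ ∃ decider : (ℕ × List (List (List ℕ)) × List ℕ) × ℕ → Bool,
      Computable decider ∧
      ∀ (n : ℕ) (S : PD0LSystem (Fin n)) (x : ℕ → Fin n)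
        (φ : (wordLanguage (Fin n)).Sentence),
        S.NonErasing → S.Generates x →
          (decider (S.code, formulaCode φ) = true ↔ WordSatisfies x φ) := by
  
  rintro ⟨decider, hcomp, hdec⟩
  obtain ⟨Q, _, M, q, g, hg, hM⟩ := DigitMachine.exists_undecidable
  obtain ⟨n, ⟨e⟩⟩ := Finite.exists_equiv_fin (DigitMachine.Letter Q)
  let φ := occursSentence (e .halt)
  let f : ℕ → Bool := fun m => decider ((M.system (M.initBlock q (g m)) e).code, formulaCode φ)
  have hf : Computable f :=
    hcomp.comp ((DigitMachine.primrec_code_system hg q).to_comp.pair (Computable.const _))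
  -- The sentence does not depend on `m`, so a decider for theories would decide halting.
  have key (m : ℕ) :
      (StateTransition.eval M.step (q, Pi.single true (g m))).Dom ↔ f m = true := by
    have hB : M.initBlock q (g m) ≠ [] := by simp [DigitMachine.initBlock, DigitMachine.pad]
    rw [hdec n _ _ φ DigitMachine.system_nonErasing (DigitMachine.system_generates hB),
      wordSatisfies_occursSentence, DigitMachine.eval_dom_iff_halt_mem,
      ← DigitMachine.exists_limitWord_eq hB]
    simp
  refine hM ⟨fun m => decidable_of_iff _ (key m).symm, hf.of_eq fun m => ?_⟩
  simp only [key, Bool.decide_eq_true]
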